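/- **Phase discrimination problem.** Let $\lambda\in(0,\pi)$. A quantum algorithm is given black-box access to a unitary $U$ on an $N$-dimensional register ($N\ge 1$) and one copy of a unit eigenvector $|\psi\rangle$ of $U$, with eigenvalue $e^{i\phi}$, $\phi\in(-\pi,\pi]$, and has to distinguish the two cases (i) $\phi=0$ and (ii) $|\phi|\in[\lambda,\pi]$. It solves the problem with bounded error $\delta$ if, for every such $U$ and $|\psi\rangle$, in each of the two cases it outputs the correct answer with probability greater than $1-\delta$. The algorithm may use a workspace of any finite dimension, arbitrary unitaries and (adaptive, intermediate) measurements that do not depend on $U$, and applications of $U$, $U^\dagger$, controlled-$U$ and controlled-$U^\dagger$; its number of queries is the total number of these applications in the worst case. **Theorem.** Any quantum algorithm that solves the phase discrimination problem with bounded error $\delta$ needs $\Omega\!\left(\frac1\lambda\log\frac1\delta\right)$ applications of $U$ and $U^\dagger$ (controlled or not) in total. Precisely: for all real $\lambda_0<\pi$ and $\delta_0<\frac12$ there is a constant $c>0$, depending only on $\lambda_0$ and $\delta_0$, such that for all $\lambda\in(0,\lambda_0]$, all $\delta\in(0,\delta_0]$ and every dimension $N\ge1$, every quantum algorithm that solves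 the phase discrimination problem on an $N$-dimensional register with gap $\lambda$ and bounded error $\delta$ makes at least $$c\cdot\frac1\lambda\log\frac1\delta$$ queries. -/

import Mathlib

open scoped Matrix Kronecker

namespace PhaseDiscrimination

/-- Basis labels of the joint system of an algorithm: a control qubit, a workspace register of
dimension `m`, and the `N`-dimensional register on which the black box `U` acts. -/
abbrev Label (m N : ℕ) : Type := Bool × Fin m × Fin N

/-- The possible answers: the eigenphase is zero, or it is bounded away from zero. -/
inductive Verdict : Type
  | zeroPhase
  | nonzeroPhase
  deriving DecidableEq

/-- The operator `U` on the joint system: identity on the control qubit and the workspace. -/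
noncomputable def plainGate (m : ℕ) {N : ℕ} (U : Matrix (Fin N) (Fin N) ℂ) :
    Matrix (Label m N) (Label m N) ℂ :=
  (1 : Matrix Bool Bool ℂ) ⊗ₖ ((1 : Matrix (Fin m) (Fin m) ℂ) ⊗ₖ U)

/-- The operator controlled-`U` on the joint system, `|0⟩⟨0| ⊗ I ⊗ I + |1⟩⟨1| ⊗ I ⊗ U`. -/
noncomputable def controlledGate (m : ℕ) {N : ℕ} (U : Matrix (Fin N) (Fin N) ℂ) :
    Matrix (Label m N) (Label m N) ℂ :=
  (Matrix.single false false 1 : Matrix Bool Bool ℂ) ⊗ₖ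
      ((1 : Matrix (Fin m) (Fin m) ℂ) ⊗ₖ (1 : Matrix (Fin N) (Fin N) ℂ)) +
    (Matrix.single true true 1 : Matrix Bool Bool ℂ) ⊗ₖ
      ((1 : Matrix (Fin m) (Fin m) ℂ) ⊗ₖ U)

/-- One application of the black box: `U` or `U†` (flag `adj`), plain or controlled
(flag `ctrl`). -/
noncomputable def queryGate (m : ℕ) {N : ℕ} (U : Matrix (Fin N) (Fin N) ℂ) (adj ctrl : Bool) :
    Matrix (Label m N) (Label m N) ℂ :=
  let W := if adj then Uᴴ else U
  if ctrl then controlledGate m W else plainGate m W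

/-- Quantum programs with black-box access to a unitary on an `N`-dimensional register. A program
gives a verdict, or makes one query, or performs an arbitrary quantum measurement on the joint
system, given by Kraus operators `K i` with `∑ i, (K i)† (K i) = I` that do not depend on `U`, and
goes on with a program that may depend on the outcome. A measurement with a single outcome is an
arbitrary unitary on the joint system. -/
inductive Program (m N : ℕ) : Type
  | answer (b : Verdict) : Program m N
  | query (adj ctrl : Bool) (next : Program m N) : Program m N
  | measure (k : ℕ) (K : Fin k → Matrix (Label m N) (Label m N) ℂ)
      (complete : ∑ i, (K i)ᴴ * K i = 1) (next : Fin k → Program m N) : Program m N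

namespace Program

/-- The number of applications of `U`, `U†` and their controlled versions, in total, on the
longest branch of the program. -/
def queries {m N : ℕ} : Program m N → ℕ
  | answer _ => 0
  | query _ _ next => next.queries + 1
  | measure _ _ _ next => Finset.univ.sup fun i => (next i).queries

/-- The probability (Born rule) that the program, run with black box `U` on the joint state `v`,
stops with verdict `b`. The state is kept unnormalized after a measurement: its squared norm is
the probability of the outcomes seen so far. -/
noncomputable def prob {m N : ℕ} (U : Matrix (Fin N) (Fin N) ℂ) (b : Verdict) :
    Program m N → (Label m N → ℂ) → ℝ
  | answer b', v => if b' = b then ∑ x, ‖v x‖ ^ 2 else 0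
  | query adj ctrl next, v => next.prob U b (queryGate m U adj ctrl *ᵥ v)
  | measure _ K _ next, v => ∑ i, (next i).prob U b (K i *ᵥ v)

end Program

/-- A quantum algorithm for phase discrimination on an `N`-dimensional register: a workspace
dimension, the basis state in which the workspace starts, and a program. -/
structure Algorithm (N : ℕ) where
  workDim : ℕ
  workInit : Fin workDim
  program : Program workDim N

namespace Algorithm

/-- The initial joint state `|0⟩ ⊗ |workInit⟩ ⊗ |ψ⟩`. -/
def initialState {N : ℕ} (A : Algorithm N) (ψ : Fin N → ℂ) : Label A.workDim N → ℂ :=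
  fun x => if x.1 = false ∧ x.2.1 = A.workInit then ψ x.2.2 else 0

/-- The total number of black-box applications made by the algorithm (in the worst case). -/
def queries {N : ℕ} (A : Algorithm N) : ℕ := A.program.queries

/-- The probability that the algorithm answers `b` when it is given the black box `U` and
the quantum state `ψ`. -/
noncomputable def answerProb {N : ℕ} (A : Algorithm N) (U : Matrix (Fin N) (Fin N) ℂ)
    (ψ : Fin N → ℂ) (b : Verdict) : ℝ :=
  A.program.prob U b (A.initialState ψ)

/-- The algorithm solves the phase discrimination problem with gap `lam` and bounded error `δ`:
for every unitary `U` and every unit eigenvector `ψ` of `U` with eigenvalue `e^{iφ}`,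
`φ ∈ (-π, π]`, the answer is correct with probability greater than `1 - δ` when `φ = 0` and
when `|φ| ∈ [lam, π]`. -/
def SolvesPhaseDiscrimination {N : ℕ} (A : Algorithm N) (lam δ : ℝ) : Prop :=
  ∀ U ∈ Matrix.unitaryGroup (Fin N) ℂ, ∀ ψ : Fin N → ℂ, ∑ i, ‖ψ i‖ ^ 2 = 1 →
    ∀ φ ∈ Set.Ioc (-Real.pi) Real.pi, U *ᵥ ψ = Complex.exp (Complex.I * φ) • ψ →
      (φ = 0 → 1 - δ < A.answerProb U ψ Verdict.zeroPhase) ∧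
      (|φ| ∈ Set.Icc lam Real.pi → 1 - δ < A.answerProb U ψ Verdict.nonzeroPhase)

end Algorithm

end PhaseDiscrimination

namespace PhaseDiscrimination

open Polynomial

/-! Polynomial method. Scalar black boxes `exp (iφ) • 1` already force the bound: every state is an
eigenvector, and a query multiplies amplitudes by `exp (±iφ)` or `1`. After `Q` queries the
amplitudes are, up to a common phase, polynomials of degree at most `Q` in `exp (iφ)`. Hence the
probability of `zeroPhase`, summed over `φ` and `-φ`, is a polynomial `P` in `cos φ` of degree at
most `Q` (`exists_polynomial_cos_eq_prob`). Correctness gives `0 ≤ P ≤ 2δ` on `[-1, cos lam]` and `P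
1 > 2 (1 - δ)`. Chebyshev extremality limits such growth to a factor `exp (2 Q tan (lam / 2))`
(`eval_one_le_mul_exp_tan`); taking logarithms finishes. -/

/-- The squared modulus of a polynomial on the unit circle, symmetrized under complex conjugation,
is a polynomial of the same degree in the cosine. -/
lemma exists_polynomial_cos_eq_norm_sq {d : ℕ} (q : ℂ[X]) (hq : q.natDegree ≤ d) :
    ∃ P : ℝ[X], P.natDegree ≤ d ∧ ∀ φ : ℝ,
      ‖q.eval (Complex.exp (Complex.I * φ))‖ ^ 2 +
        ‖q.eval (Complex.exp (Complex.I * (-φ : ℝ)))‖ ^ 2 = P.eval (Real.cos φ) := by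
  have key : ∀ φ : ℝ, ‖q.eval (Complex.exp (Complex.I * φ))‖ ^ 2 =
      ∑ i ∈ Finset.range (d + 1), ∑ j ∈ Finset.range (d + 1),
        ((q.coeff i * star (q.coeff j)).re * Real.cos (((i - j : ℤ) : ℝ) * φ) -
          (q.coeff i * star (q.coeff j)).im * Real.sin (((i - j : ℤ) : ℝ) * φ)) := by
    intro φ
    have hpow : ∀ i j : ℕ, Complex.exp (Complex.I * φ) ^ i *
        star (Complex.exp (Complex.I * φ) ^ j) =
          (Real.cos (((i - j : ℤ) : ℝ) * φ) : ℂ) +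
            (Real.sin (((i - j : ℤ) : ℝ) * φ) : ℂ) * Complex.I := by
      intro i j
      rw [Complex.ofReal_cos, Complex.ofReal_sin, ← Complex.exp_mul_I, star_pow]
      change _ * (starRingEnd ℂ (Complex.exp (Complex.I * φ))) ^ j = _
      rw [← Complex.exp_conj, ← Complex.exp_nat_mul, ← Complex.exp_nat_mul, ← Complex.exp_add]
      congr 1
      simp
      ring
    have h1 : ((‖q.eval (Complex.exp (Complex.I * φ))‖ ^ 2 : ℝ) : ℂ) =
        ∑ i ∈ Finset.range (d + 1), ∑ j ∈ Finset.range (d + 1),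
          (q.coeff i * star (q.coeff j)) * ((Real.cos (((i - j : ℤ) : ℝ) * φ) : ℂ) +
            (Real.sin (((i - j : ℤ) : ℝ) * φ) : ℂ) * Complex.I) := by
      rw [Complex.ofReal_pow, ← Complex.mul_conj',
        eval_eq_sum_range' (Nat.lt_succ_of_le hq), map_sum, Finset.sum_mul_sum]
      refine Finset.sum_congr rfl fun i _ => Finset.sum_congr rfl fun j _ => ?_
      rw [← hpow, map_mul, starRingEnd_apply, starRingEnd_apply]
      ring
    have h2 := congrArg Complex.re h1
    rw [Complex.ofReal_re] at h2
    rw [h2]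
    simp only [Complex.re_sum]
    refine Finset.sum_congr rfl fun i _ => Finset.sum_congr rfl fun j _ => ?_
    rw [Complex.mul_re]
    congr 1 <;> congr 1
    · rw [Complex.add_re, Complex.re_ofReal_mul, Complex.I_re, Complex.ofReal_re]; ring
    · rw [Complex.add_im, Complex.im_ofReal_mul, Complex.I_im, Complex.ofReal_im]; ring
  -- The sine terms are odd in `φ` and cancel; `|i - j| ≤ d` keeps the degree at `d` rather than `2
  -- * d`.
  refine ⟨∑ i ∈ Finset.range (d + 1), ∑ j ∈ Finset.range (d + 1),
    C (2 * (q.coeff i * star (q.coeff j)).re) * Chebyshev.T ℝ (i - j), ?_, fun φ => ?_⟩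
  · refine natDegree_sum_le_of_forall_le _ _ fun i hi =>
      natDegree_sum_le_of_forall_le _ _ fun j hj => (natDegree_C_mul_le _ _).trans ?_
    rw [Chebyshev.natDegree_T]
    rw [Finset.mem_range] at hi hj
    omega
  · rw [key, key, ← Finset.sum_add_distrib, eval_finsetSum]
    refine Finset.sum_congr rfl fun i _ => ?_
    rw [← Finset.sum_add_distrib, eval_finsetSum]
    refine Finset.sum_congr rfl fun j _ => ?_
    rw [eval_mul, eval_C, Chebyshev.T_real_cos, mul_neg, Real.cos_neg, Real.sin_neg]
    ring

/-- A polynomial bounded by `M` on `[-1, cos θ]` is at most `M exp (2 d tan (θ / 2))` at `1`. -/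
lemma eval_one_le_mul_exp_tan {d : ℕ} {P : ℝ[X]} {θ M : ℝ} (hd : P.natDegree ≤ d)
    (hθ : 0 < θ) (hθπ : θ < Real.pi) (hM : 0 < M)
    (hP : ∀ φ ∈ Set.Icc θ Real.pi, |P.eval (Real.cos φ)| ≤ M) :
    P.eval 1 ≤ M * Real.exp (2 * d * Real.tan (θ / 2)) := by
  have hc : 0 < Real.cos (θ / 2) := Real.cos_pos_of_mem_Ioo ⟨by linarith, by linarith⟩
  have hcos : Real.cos θ = 2 * Real.cos (θ / 2) ^ 2 - 1 := by
    rw [← Real.cos_two_mul]; ring_nf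
  set t := Real.tan (θ / 2) with ht
  have ht0 : 0 ≤ t := Real.tan_nonneg_of_nonneg_of_le_pi_div_two (by linarith) (by linarith)
  have htc : t * Real.cos (θ / 2) = Real.sin (θ / 2) := Real.tan_mul_cos hc.ne'
  -- The affine map `L` below carries `[-1, 1]` onto `[-1, cos θ]`, and this value to `1`. In this
  -- form `T_d` there is `cosh (2 d arsinh t)`.
  have hcosh : Real.cosh (2 * Real.arsinh t) = 1 + 2 * t ^ 2 := by
    rw [Real.cosh_two_mul, Real.cosh_sq, Real.sinh_arsinh]; ring
  have harsinh : Real.arsinh t ≤ t := by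
    have h := Real.self_le_sinh_iff.2 (Real.arsinh_nonneg_iff.2 ht0)
    rwa [Real.sinh_arsinh] at h
  set L : ℝ[X] := C ((Real.cos θ - 1) / 2) + C ((Real.cos θ + 1) / 2) * X with hL
  have hLdeg : L.natDegree ≤ 1 := by
    rw [hL]; compute_degree
  set R : ℝ[X] := C M⁻¹ * P.comp L with hR
  have hRdeg : R.degree ≤ d := by
    refine natDegree_le_iff_degree_le.1 ((natDegree_C_mul_le _ _).trans ?_)
    exact natDegree_comp_le.trans ((Nat.mul_le_mul hd hLdeg).trans_eq (mul_one d))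
  have hbound : ∀ x ∈ Set.Icc (-1 : ℝ) 1, |R.eval x| ≤ 1 := by
    intro x hx
    have h1 := Real.neg_one_le_cos θ
    have h2 := Real.cos_le_one θ
    set y := L.eval x with hy
    have hy' : y = (Real.cos θ - 1) / 2 + (Real.cos θ + 1) / 2 * x := by simp [hy, hL]
    have hyl : -1 ≤ y := by rw [hy']; nlinarith [hx.1]
    have hyu : y ≤ Real.cos θ := by rw [hy']; nlinarith [hx.2]
    have hb := hP (Real.arccos y) ⟨by
      rw [← Real.arccos_cos hθ.le hθπ.le]; exact Real.arccos_le_arccos hyu, Real.arccos_le_pi y⟩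
    rw [Real.cos_arccos hyl (hyu.trans h2)] at hb
    rw [hR, eval_mul, eval_C, eval_comp, abs_mul, abs_of_pos (inv_pos.2 hM)]
    rw [inv_mul_le_iff₀ hM, mul_one]
    exact hb
  have hx : 1 ≤ Real.cosh (2 * Real.arsinh t) := Real.one_le_cosh _
  -- The zeroth derivative: `T_d` grows fastest outside `[-1, 1]`.
  have hmain := Chebyshev.eval_iterate_derivative_le_of_forall_abs_le_one (k := 0) hx hRdeg hbound
  simp only [Function.iterate_zero, id_eq] at hmain
  rw [Chebyshev.T_real_cosh] at hmain
  have hL1 : L.eval (Real.cosh (2 * Real.arsinh t)) = 1 := by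
    rw [hcosh]
    simp only [hL, eval_add, eval_mul, eval_C, eval_X, hcos]
    have := Real.sin_sq_add_cos_sq (θ / 2)
    rw [← htc] at this
    linear_combination 2 * this
  rw [hR, eval_mul, eval_C, eval_comp, hL1, inv_mul_le_iff₀ hM] at hmain
  refine hmain.trans (mul_le_mul_of_nonneg_left ?_ hM.le)
  have hle : (((d : ℤ) : ℝ) * (2 * Real.arsinh t)) ≤ 2 * d * t := by
    push_cast
    have : (0 : ℝ) ≤ d := d.cast_nonneg
    nlinarith
  have hnn : 0 ≤ (((d : ℤ) : ℝ) * (2 * Real.arsinh t)) := by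
    have := Real.arsinh_nonneg_iff.2 ht0
    positivity
  refine le_trans ?_ (Real.exp_le_exp.2 hle)
  rw [Real.cosh_eq]
  have : Real.exp (-(((d : ℤ) : ℝ) * (2 * Real.arsinh t))) ≤
      Real.exp (((d : ℤ) : ℝ) * (2 * Real.arsinh t)) := Real.exp_le_exp.2 (by linarith)
  linarith

/-! ### Programs run on scalar black boxes -/

/-- The factor by which a query to the scalar black box `z` multiplies the basis states whose
control qubit is `a`. -/
noncomputable def queryPhase (z : ℂ) (adj ctrl a : Bool) : ℂ :=
  if ctrl && !a then 1 else if adj then star z else z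

lemma queryGate_smul_one_mulVec {m N : ℕ} (z : ℂ) (adj ctrl : Bool) (v : Label m N → ℂ) :
    queryGate m (z • (1 : Matrix (Fin N) (Fin N) ℂ)) adj ctrl *ᵥ v =
      fun x => queryPhase z adj ctrl x.1 * v x := by
  have h : queryGate m (z • (1 : Matrix (Fin N) (Fin N) ℂ)) adj ctrl =
      Matrix.diagonal fun x => queryPhase z adj ctrl x.1 := by
    have hW : (if adj then (z • (1 : Matrix (Fin N) (Fin N) ℂ))ᴴ else z • 1) =
        (if adj then star z else z) • (1 : Matrix (Fin N) (Fin N) ℂ) := by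
      cases adj <;> simp
    rw [queryGate, hW]
    ext ⟨a, i, j⟩ ⟨a', i', j'⟩
    generalize hw : (if adj then star z else z) = w
    cases ctrl <;> cases a <;> cases a' <;> by_cases hi : i = i' <;> by_cases hj : j = j' <;>
      simp [queryPhase, plainGate, controlledGate, hi, hj] <;>
        exact hw.symm
  rw [h]
  funext x
  rw [Matrix.mulVec_diagonal]

lemma norm_queryPhase {z : ℂ} (hz : ‖z‖ = 1) (adj ctrl a : Bool) :
    ‖queryPhase z adj ctrl a‖ = 1 := by
  cases adj <;> cases ctrl <;> cases a <;> simp [queryPhase, hz]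

lemma sum_norm_sq_kraus {ι : Type*} [Fintype ι] [DecidableEq ι] {k : ℕ}
    (K : Fin k → Matrix ι ι ℂ) (hK : ∑ i, (K i)ᴴ * K i = 1) (v : ι → ℂ) :
    ∑ i, ∑ x, ‖(K i *ᵥ v) x‖ ^ 2 = ∑ x, ‖v x‖ ^ 2 := by
  have hnorm : ∀ w : ι → ℂ, ((∑ x, ‖w x‖ ^ 2 : ℝ) : ℂ) = star w ⬝ᵥ w := by
    intro w
    simp [dotProduct, Complex.conj_mul']
  have h : ((∑ i, ∑ x, ‖(K i *ᵥ v) x‖ ^ 2 : ℝ) : ℂ) = ((∑ x, ‖v x‖ ^ 2 : ℝ) : ℂ) := by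
    rw [hnorm, Complex.ofReal_sum]
    simp_rw [hnorm, Matrix.star_mulVec, Matrix.dotProduct_mulVec, Matrix.vecMul_vecMul]
    rw [← sum_dotProduct, ← Matrix.vecMul_sum, hK, Matrix.vecMul_one]
  exact_mod_cast h

namespace Program

lemma prob_nonneg {m N : ℕ} (U : Matrix (Fin N) (Fin N) ℂ) (b : Verdict) (p : Program m N) :
    ∀ v : Label m N → ℂ, 0 ≤ p.prob U b v := by
  induction p with
  | answer b' => intro v; rw [prob]; split_ifs <;> positivity
  | query adj ctrl next ih => intro v; exact ih _
  | measure k K hK next ih => intro v; exact Finset.sum_nonneg fun i _ => ih i _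

/-- Unimodular phases and complete Kraus families preserve total squared norm. This turns a likely
`nonzeroPhase` into an upper bound for `zeroPhase`. -/
lemma prob_add_prob {m N : ℕ} {z : ℂ} (hz : ‖z‖ = 1) (p : Program m N) :
    ∀ v : Label m N → ℂ, p.prob (z • 1) Verdict.zeroPhase v +
      p.prob (z • 1) Verdict.nonzeroPhase v = ∑ x, ‖v x‖ ^ 2 := by
  induction p with
  | answer b' => intro v; cases b' <;> simp [prob]
  | query adj ctrl next ih =>
    intro v
    rw [prob, prob, ih, queryGate_smul_one_mulVec]
    simp [norm_queryPhase hz]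
  | measure k K hK next ih =>
    intro v
    rw [prob, prob, ← Finset.sum_add_distrib, ← sum_norm_sq_kraus K hK v]
    exact Finset.sum_congr rfl fun i _ => ih i _

/-- If the amplitudes of the initial state are, up to a common phase, polynomials of degree at most
`d` in `exp (iφ)`, then the probability of a verdict under the black box `exp (iφ)`, symmetrized in
`φ`, is a polynomial in `cos φ` whose degree is at most `d` plus the number of queries. -/
lemma exists_polynomial_cos_eq_prob {m N : ℕ} (b : Verdict) (p : Program m N) :
    ∀ (d k : ℕ) (q : Label m N → ℂ[X]) (v : ℝ → Label m N → ℂ), (∀ x, (q x).natDegree ≤ d) →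
      (∀ φ x, v φ x = star (Complex.exp (Complex.I * φ)) ^ k *
        (q x).eval (Complex.exp (Complex.I * φ))) →
      ∃ P : ℝ[X], P.natDegree ≤ d + p.queries ∧ ∀ φ : ℝ,
        p.prob (Complex.exp (Complex.I * φ) • 1) b (v φ) +
          p.prob (Complex.exp (Complex.I * (-φ : ℝ)) • 1) b (v (-φ)) = P.eval (Real.cos φ) := by
  have hexp : ∀ φ : ℝ, ‖Complex.exp (Complex.I * φ)‖ = 1 := fun φ => by
    rw [mul_comm]; exact Complex.norm_exp_ofReal_mul_I φ
  induction p with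
  | answer b' =>
    intro d k q v hq hv
    by_cases hb : b' = b
    · choose P hPd hP using fun x => exists_polynomial_cos_eq_norm_sq (q x) (hq x)
      refine ⟨∑ x, P x, natDegree_sum_le_of_forall_le _ _ fun x _ => hPd x, fun φ => ?_⟩
      rw [prob, prob, if_pos hb, if_pos hb, ← Finset.sum_add_distrib, eval_finsetSum]
      refine Finset.sum_congr rfl fun x _ => ?_
      rw [← hP, hv, hv, norm_mul, norm_mul, norm_pow, norm_pow, norm_star, norm_star, hexp, hexp]
      simp
    · exact ⟨0, by simp, fun φ => by simp [prob, hb]⟩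
  | query adj ctrl next ih =>
    intro d k q v hq hv
    have hstar : ∀ φ : ℝ, star (Complex.exp (Complex.I * φ)) * Complex.exp (Complex.I * φ) = 1 :=
      fun φ => by
        have := Complex.conj_mul' (Complex.exp (Complex.I * φ))
        rw [hexp] at this
        simpa using this
    -- An adjoint query puts one more conjugate phase into the common factor, so it is the
    -- amplitudes it leaves alone that gain a compensating `X`. Either way the degree rises by at
    -- most one.
    obtain ⟨P, hPd, hP⟩ := ih (d + 1) (if adj then k + 1 else k)
      (fun x => if (ctrl && !x.1) = adj then X * q x else q x)
      (fun φ => queryGate m (Complex.exp (Complex.I * φ) • 1) adj ctrl *ᵥ v φ)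
      (fun x => by
        have h1 : (X * q x).natDegree ≤ d + 1 := by
          refine natDegree_mul_le.trans ?_
          rw [natDegree_X, add_comm]
          exact Nat.add_le_add_right (hq x) 1
        split_ifs
        · exact h1
        · exact (hq x).trans d.le_succ)
      (fun φ x => by
        simp only [queryGate_smul_one_mulVec, hv]
        cases adj <;> cases h : (ctrl && !x.1) <;>
          simp only [queryPhase, h, if_true, if_false, reduceCtorEq, eval_mul, eval_X,
            Bool.false_eq_true]
        · ring
        · ring
        · ring
        · linear_combination -(star (Complex.exp (Complex.I * φ)) ^ k *
            (q x).eval (Complex.exp (Complex.I * φ))) * hstar φ)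
    refine ⟨P, hPd.trans_eq ?_, fun φ => hP φ⟩
    rw [queries]; ring
  | measure n K hK next ih =>
    intro d k q v hq hv
    choose P hPd hP using fun i => ih i d k (fun x => ∑ y, C (K i x y) * q y)
      (fun φ => K i *ᵥ v φ)
      (fun x => natDegree_sum_le_of_forall_le _ _ fun y _ =>
        (natDegree_C_mul_le _ _).trans (hq y))
      (fun φ x => by
        rw [eval_finsetSum, Finset.mul_sum, Matrix.mulVec, dotProduct]
        refine Finset.sum_congr rfl fun y _ => ?_
        rw [hv, eval_mul, eval_C]
        ring)
    refine ⟨∑ i, P i, natDegree_sum_le_of_forall_le _ _ fun i _ => (hPd i).trans ?_, fun φ => ?_⟩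
    · rw [queries]
      exact Nat.add_le_add_left
        (Finset.le_sup (f := fun i => (next i).queries) (Finset.mem_univ i)) d
    · rw [prob, prob, ← Finset.sum_add_distrib, eval_finsetSum]
      exact Finset.sum_congr rfl fun i _ => hP i φ

end Program

/-! ### Error versus number of queries -/

namespace Algorithm

lemma sum_norm_sq_initialState {N : ℕ} (A : Algorithm N) (ψ : Fin N → ℂ) :
    ∑ x, ‖A.initialState ψ x‖ ^ 2 = ∑ i, ‖ψ i‖ ^ 2 := by
  rw [Fintype.sum_prod_type, Fintype.sum_bool, Fintype.sum_prod_type, Fintype.sum_prod_type,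
    Finset.sum_eq_zero (s := Finset.univ) (f := fun a => ∑ y, _), zero_add,
    Finset.sum_eq_single A.workInit]
  · simp [initialState]
  · intro a _ ha; simp [initialState, ha]
  · simp
  · intro a _; simp [initialState]

/-- The trade-off between the error and the number of queries. -/
theorem SolvesPhaseDiscrimination.one_sub_le {N : ℕ} {A : Algorithm N} {lam δ : ℝ}
    (hA : A.SolvesPhaseDiscrimination lam δ) (hN : 1 ≤ N) (hlam : 0 < lam) (hlamπ : lam < Real.pi)
    (hδ : 0 < δ) : 1 - δ ≤ δ * Real.exp (2 * A.queries * Real.tan (lam / 2)) := by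
  set ψ : Fin N → ℂ := Pi.single ⟨0, hN⟩ 1 with hψ
  have hψ1 : ∑ i, ‖ψ i‖ ^ 2 = 1 := by
    rw [Finset.sum_eq_single ⟨0, hN⟩]
    · simp [hψ]
    · intro i _ hi; simp [hψ, hi]
    · simp
  have hexp : ∀ φ : ℝ, ‖Complex.exp (Complex.I * φ)‖ = 1 := fun φ => by
    rw [mul_comm]; exact Complex.norm_exp_ofReal_mul_I φ
  set r : ℝ → ℝ := fun φ =>
    A.answerProb (Complex.exp (Complex.I * φ) • 1) ψ Verdict.zeroPhase with hr
  have hunit : ∀ φ : ℝ, Complex.exp (Complex.I * φ) • (1 : Matrix (Fin N) (Fin N) ℂ) ∈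
      Matrix.unitaryGroup (Fin N) ℂ := by
    intro φ
    rw [Matrix.mem_unitaryGroup_iff, star_smul, star_one, smul_mul_smul_comm, mul_one]
    have := Complex.mul_conj' (Complex.exp (Complex.I * φ))
    rw [hexp] at this
    rw [Complex.star_def, this]
    simp
  have hsolve := fun φ hφ => hA _ (hunit φ) ψ hψ1 φ hφ (by rw [Matrix.smul_mulVec,
    Matrix.one_mulVec])
  have hr_nonneg : ∀ φ, 0 ≤ r φ := fun φ => Program.prob_nonneg _ _ _ _
  have hr_zero : 1 - δ < r 0 := (hsolve 0 ⟨by linarith, by linarith⟩).1 rfl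
  have hr_lt : ∀ φ ∈ Set.Ioc (-Real.pi) Real.pi, lam ≤ |φ| → r φ < δ := by
    intro φ hφ hl
    have h1 := (hsolve φ hφ).2 ⟨hl, abs_le.2 ⟨hφ.1.le, hφ.2⟩⟩
    have h2 := Program.prob_add_prob (hexp φ) A.program (A.initialState ψ)
    rw [sum_norm_sq_initialState, hψ1] at h2
    have h3 : r φ + A.answerProb (Complex.exp (Complex.I * φ) • 1) ψ Verdict.nonzeroPhase = 1 := h2
    linarith
  -- The eigenphase range omits `-π`, which the symmetrization needs at `φ = π`.
  have hr_pi : r (-Real.pi) = r Real.pi := by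
    have : Complex.exp (Complex.I * (-Real.pi : ℝ)) = Complex.exp (Complex.I * Real.pi) := by
      rw [mul_comm, mul_comm Complex.I, Complex.exp_pi_mul_I, Complex.ofReal_neg, neg_mul,
        Complex.exp_neg, Complex.exp_pi_mul_I]
      norm_num
    simp only [hr, this]
  obtain ⟨P, hPd, hP⟩ := A.program.exists_polynomial_cos_eq_prob Verdict.zeroPhase 0 0
    (fun x => C (A.initialState ψ x)) (fun _ => A.initialState ψ) (fun x => by simp)
    (fun φ x => by simp)
  rw [zero_add] at hPd
  have hP' : ∀ φ, r φ + r (-φ) = P.eval (Real.cos φ) := hP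
  have hbound : ∀ φ ∈ Set.Icc lam Real.pi, |P.eval (Real.cos φ)| ≤ 2 * δ := by
    intro φ hφ
    have h0 : 0 < φ := hlam.trans_le hφ.1
    have h1 := hr_lt φ ⟨by linarith, hφ.2⟩ (hφ.1.trans (le_abs_self φ))
    have h2 : r (-φ) < δ := by
      rcases hφ.2.eq_or_lt with h | h
      · rw [h, hr_pi, ← h]; exact h1
      · exact hr_lt (-φ) ⟨by linarith, by linarith⟩ (by rw [abs_neg, abs_of_pos h0]; exact hφ.1)
    rw [← hP', abs_of_nonneg (add_nonneg (hr_nonneg _) (hr_nonneg _))]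
    linarith
  have hmain := eval_one_le_mul_exp_tan hPd hlam hlamπ (by linarith) hbound
  have h0 := hP' 0
  rw [neg_zero, Real.cos_zero] at h0
  change _ ≤ δ * Real.exp (2 * A.program.queries * _)
  linarith

end Algorithm

end PhaseDiscrimination

theorem mainTheorem2 (lam₀ δ₀ : ℝ) (hlam₀ : lam₀ < Real.pi) (hδ₀ : δ₀ < 1 / 2) :
    ∃ c : ℝ, 0 < c ∧
      ∀ lam ∈ Set.Ioc (0 : ℝ) lam₀, ∀ δ ∈ Set.Ioc (0 : ℝ) δ₀,
        ∀ N : ℕ, 1 ≤ N → ∀ A : PhaseDiscrimination.Algorithm N,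
          A.SolvesPhaseDiscrimination lam δ →
            c * (1 / lam * Real.log (1 / δ)) ≤ (A.queries : ℝ) := by
  rcases le_or_gt lam₀ 0 with hl | hl
  · exact ⟨1, one_pos, fun lam h => absurd (h.1.trans_le h.2) hl.not_gt⟩
  rcases le_or_gt δ₀ 0 with hd | hd
  · exact ⟨1, one_pos, fun _ _ δ h => absurd (h.1.trans_le h.2) hd.not_gt⟩
  have hcos : 0 < Real.cos (lam₀ / 2) := Real.cos_pos_of_mem_Ioo ⟨by linarith, by linarith⟩
  have hlog₀ : 0 < Real.log (1 / δ₀) :=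
    Real.log_pos (by rw [lt_div_iff₀ hd]; linarith)
  have hratio : Real.log (1 / (1 - δ₀)) < Real.log (1 / δ₀) :=
    Real.log_lt_log (one_div_pos.2 (by linarith)) (one_div_lt_one_div_of_lt hd (by linarith))
  -- Chosen so that `κ * log (1 / δ) ≤ log ((1 - δ) / δ)` for `δ ≤ δ₀`, with equality at `δ₀`; it is
  -- positive because `δ₀ < 1 / 2`.
  set κ := 1 - Real.log (1 / (1 - δ₀)) / Real.log (1 / δ₀) with hκ
  have hκ0 : 0 < κ := by
    rw [hκ, sub_pos, div_lt_one hlog₀]; exact hratio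
  have hκ1 : κ ≤ 1 := by
    have : 0 ≤ Real.log (1 / (1 - δ₀)) :=
      Real.log_nonneg (by rw [le_div_iff₀ (by linarith)]; linarith)
    rw [hκ]
    linarith [div_nonneg this hlog₀.le]
  refine ⟨κ * Real.cos (lam₀ / 2), mul_pos hκ0 hcos, ?_⟩
  rintro lam ⟨hlam, hlam'⟩ δ ⟨hδ, hδ'⟩ N hN A hA
  have hmain := hA.one_sub_le hN hlam (hlam'.trans_lt hlam₀) hδ
  have hQ : (0 : ℝ) ≤ A.queries := Nat.cast_nonneg _
  have hlog := Real.log_le_log (by linarith) hmain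
  rw [Real.log_mul hδ.ne' (Real.exp_pos _).ne', Real.log_exp] at hlog
  -- Linearizes the tangent uniformly on `(0, lam₀]`; this is where `lam₀ < π` enters the constant.
  have htan : 2 * Real.tan (lam / 2) ≤ lam / Real.cos (lam₀ / 2) := by
    rw [Real.tan_eq_sin_div_cos, ← mul_div_assoc]
    refine div_le_div₀ hlam.le ?_ hcos ?_
    · linarith [Real.sin_le (show 0 ≤ lam / 2 by linarith)]
    · exact Real.cos_le_cos_of_nonneg_of_le_pi (by linarith) (by linarith) (by linarith)
  have hκlog : κ * Real.log (1 / δ) ≤ Real.log (1 - δ) - Real.log δ := by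
    have h1 : Real.log (1 - δ₀) ≤ Real.log (1 - δ) :=
      Real.log_le_log (by linarith) (by linarith)
    have h2 : Real.log (1 / δ₀) ≤ Real.log (1 / δ) :=
      Real.log_le_log (by positivity) (one_div_le_one_div_of_le hδ hδ')
    have h3 : (1 - κ) * Real.log (1 / δ₀) = Real.log (1 / (1 - δ₀)) := by
      rw [hκ, sub_sub_cancel, div_mul_cancel₀ _ hlog₀.ne']
    have h4 := mul_le_mul_of_nonneg_left h2 (sub_nonneg.2 hκ1)
    rw [h3, one_div (1 - δ₀), Real.log_inv] at h4
    have h5 : Real.log (1 / δ) = -Real.log δ := by rw [one_div, Real.log_inv]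
    linarith
  have hfinal : κ * Real.log (1 / δ) ≤ A.queries * (lam / Real.cos (lam₀ / 2)) := by
    have := mul_le_mul_of_nonneg_left htan hQ
    linarith
  rw [← mul_div_assoc, le_div_iff₀ hcos] at hfinal
  rw [one_div_mul_eq_div, ← mul_div_assoc, div_le_iff₀ hlam]
  linarith
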